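/- Write $\mathbb{C}_+=\{s\in\mathbb{C}:\mathrm{Re}(s)>0\}$ and $\mathcal{L}(g)(s)=\int_0^\infty e^{-st}g(t)\,dt$. Let $H^2(\mathbb{C}_+)$ be the Hardy space of functions $\Phi$ analytic on $\mathbb{C}_+$ for which $\big(\frac{1}{2\pi}\int_{-\infty}^\infty|\Phi(x+iy)|^2dy\big)^{1/2}$ is bounded uniformly in $x>0$. For $f$ analytic on a region (connected open set) containing $0$ and $\mathbb{C}_+$, let $D_f$ be the set of all pairs $(\phi,r)$, with $\phi\in L^2(\mathbb{R}_+)$ and $r$ analytic on some region of $\mathbb{C}$, such that $f\,\mathcal{L}(\phi)-r$ belongs to $H^2(\mathbb{C}_+)$. Let $\partial_t$ be the (weak) derivative as an operator in $L^2(\mathbb{R}_+)$, with its maximal domain. A vector $\phi\in L^2(\mathbb{R}_+)$ is called $f$-analytic for $\partial_t$ if $\phi$ is in the domain of $\partial_t^n$ for all $n\ge 0$ and the series $\sum_{n\ge 0}\frac{f^{(n)}(0)}{n!}\partial_t^n\phi$ converges in $L^2(\mathbb{R}_+)$. **Proposition.** Let $f$ be analytic on a region containing $0$ and $\mathbb{C}_+$,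 and suppose that the radius of convergence $R_1\in(0,\infty]$ of the Taylor series $\sum_{n\ge0}\frac{f^{(n)}(0)}{n!}s^n$ satisfies $R_1>1$. Let $\phi\in C^\infty([0,\infty))\cap L^2(\mathbb{R}_+)$ be an $f$-analytic vector for $\partial_t$, put $d_j=\phi^{(j)}(0)$, and suppose that for some $0<R<1$ the series $\sum_{j\ge1}d_{j-1}s^{-j}$ converges uniformly on compact subsets of $\{|s|>R\}$. Then the series $$r(s)=\sum_{n=1}^\infty\sum_{j=1}^n\frac{f^{(n)}(0)}{n!}\,d_{j-1}\,s^{n-j}$$ (summed over $n$, with the inner finite sums as terms) converges absolutely to an analytic function on the disc $\{|s|<R_1\}$, and there is an analytic function $r_e$ on $\mathbb{C}_+$ which continues $r$ analytically, i.e. $r_e(s)=r(s)$ for all $s\in\mathbb{C}_+$ with $|s|<R_1$, and such that $(\phi,r_e)\in D_f$. -/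

import Mathlib

open MeasureTheory Set Filter Topology
open scoped ContDiff ENNReal NNReal

noncomputable section

/-- The open right half-plane `ℂ₊ = {s : Re s > 0}`. -/
def rightHalfPlane : Set ℂ := {s | 0 < s.re}

/-- The Hilbert space `L²(ℝ₊)` of complex-valued functions on the half-line. -/
abbrev L2Pos : Type := Lp ℂ 2 ((volume : Measure ℝ).restrict (Ioi 0))

/-- The Laplace transform `𝓛(g)(s) = ∫₀^∞ e^{-st} g(t) dt`. -/
def laplace (g : ℝ → ℂ) (s : ℂ) : ℂ := ∫ t in Ioi (0 : ℝ), Complex.exp (-s * t) * g t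

/-- The mean `μ_q(Φ, x) = ((1/2π) ∫ |Φ(x + iy)|^q dy)^{1/q}`, with values in `[0, ∞]`. -/
def hardyMean (q : ℝ) (Φ : ℂ → ℂ) (x : ℝ) : ℝ≥0∞ :=
  (ENNReal.ofReal (1 / (2 * Real.pi)) *
    ∫⁻ y : ℝ, ‖Φ ((x : ℂ) + (y : ℂ) * Complex.I)‖ₑ ^ q) ^ (1 / q)

/-- The Hardy space `H^q(ℂ₊)`: functions analytic on `ℂ₊` for which `μ_q(Φ, x)` is bounded
uniformly in `x > 0`. -/
def hardySpace (q : ℝ) : Set (ℂ → ℂ) :=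
  {Φ | AnalyticOnNhd ℂ Φ rightHalfPlane ∧
    ∃ C : ℝ≥0, ∀ x : ℝ, 0 < x → hardyMean q Φ x ≤ (C : ℝ≥0∞)}

/-- A region: a non-empty, connected open subset of `ℂ`. -/
def IsRegion (Ω : Set ℂ) : Prop := IsOpen Ω ∧ IsConnected Ω

/-- The space `𝓗` of functions that are analytic on some region of `ℂ`. -/
def analyticOnRegions : Set (ℂ → ℂ) := {r | ∃ Ω, IsRegion Ω ∧ AnalyticOnNhd ℂ r Ω}

/-- The domain `D_f` of `f(∂_t)`: pairs `(φ, r)` in `L²(ℝ₊) × 𝓗` such that `f 𝓛(φ) - r` belongs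
to the Hardy space `H²(ℂ₊)`. -/
def domainD (f : ℂ → ℂ) : Set (L2Pos × (ℂ → ℂ)) :=
  {p | p.2 ∈ analyticOnRegions ∧ (fun s => f s * laplace (p.1 : ℝ → ℂ) s - p.2 s) ∈ hardySpace 2}

/-- The Taylor coefficient `f⁽ⁿ⁾(0) / n!`. -/
def taylorCoeff (f : ℂ → ℂ) (n : ℕ) : ℂ := iteratedDeriv n f 0 / (n.factorial : ℂ)

/-- The radius of convergence, in `[0, ∞]`, of the Taylor series of `f` at `0`. -/
def taylorRadius (f : ℂ → ℂ) : ℝ≥0∞ :=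
  (FormalMultilinearSeries.ofScalars ℂ (taylorCoeff f)).radius

/-- The open disc `|s| < R₁`, where `R₁` is the radius of convergence of the Taylor series of `f`
at `0` (all of `ℂ` if `R₁ = ∞`). -/
def taylorDisc (f : ℂ → ℂ) : Set ℂ := {s | ‖s‖ₑ < taylorRadius f}

/-- The `n`-th term `∑_{j=1}^n (f⁽ⁿ⁾(0) / n!) d_{j-1} s^{n-j}` of the series `r`. -/
def rTerm (f : ℂ → ℂ) (d : ℕ → ℂ) (s : ℂ) (n : ℕ) : ℂ :=
  ∑ j ∈ Finset.Icc 1 n, taylorCoeff f n * d (j - 1) * s ^ (n - j)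

/-- The sum of the series `r(s) = ∑_{n ≥ 1} ∑_{j=1}^n (f⁽ⁿ⁾(0) / n!) d_{j-1} s^{n-j}`
(the term `n = 0` is an empty sum). -/
def rSeries (f : ℂ → ℂ) (d : ℕ → ℂ) (s : ℂ) : ℂ := ∑' n, rTerm f d s n

/-- For some `0 < R < 1`, the series `∑_{j ≥ 1} d_{j-1} / s^j` converges uniformly on the compact
subsets of `{|s| > R}`. -/
def ConvergesOutsideSmallDisc (d : ℕ → ℂ) : Prop :=
  ∃ R : ℝ, 0 < R ∧ R < 1 ∧ ∃ g : ℂ → ℂ, ∀ K : Set ℂ, IsCompact K → K ⊆ {s : ℂ | R < ‖s‖} →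
    TendstoUniformlyOn (fun (N : ℕ) (s : ℂ) => ∑ j ∈ Finset.Icc 1 N, d (j - 1) / s ^ j) g atTop K

/-- `v` is an `f`-analytic vector for the (partially defined) linear operator `A`: it lies in the
domain of every power of `A` (here `w n` is `A ^ n v`) and `∑ (f⁽ⁿ⁾(0) / n!) A ^ n v` converges
in norm. -/
def IsAnalyticVector {V : Type*} [NormedAddCommGroup V] [NormedSpace ℂ V]
    (f : ℂ → ℂ) (A : V →ₗ.[ℂ] V) (v : V) : Prop :=
  ∃ w : ℕ → V, w 0 = v ∧ (∀ n, ∃ h : w n ∈ A.domain, A ⟨w n, h⟩ = w (n + 1)) ∧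
    ∃ S : V, Tendsto (fun N => ∑ n ∈ Finset.range N, taylorCoeff f n • w n) atTop (𝓝 S)

/-- `v` is the weak derivative of `u` on `(0, ∞)`. -/
def IsWeakDeriv (u v : ℝ → ℂ) : Prop :=
  ∀ ψ : ℝ → ℝ, ContDiff ℝ ∞ ψ → HasCompactSupport ψ → tsupport ψ ⊆ Ioi 0 →
    ∫ t in Ioi (0 : ℝ), deriv ψ t • u t = -∫ t in Ioi (0 : ℝ), ψ t • v t

theorem L2Pos.integrable_smul (u : L2Pos) {ψ : ℝ → ℝ} (hψ : Continuous ψ)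
    (hc : HasCompactSupport ψ) :
    Integrable (fun t => ψ t • u t) ((volume : Measure ℝ).restrict (Ioi 0)) :=
  ((Lp.memLp u).locallyIntegrable (by norm_num)).integrable_smul_left_of_hasCompactSupport hψ hc

theorem L2Pos.setIntegral_add (u v : L2Pos) {ψ : ℝ → ℝ} (hψ : Continuous ψ)
    (hc : HasCompactSupport ψ) :
    ∫ t in Ioi (0 : ℝ), ψ t • (u + v : L2Pos) t =
      (∫ t in Ioi (0 : ℝ), ψ t • u t) + ∫ t in Ioi (0 : ℝ), ψ t • v t := by
  rw [← integral_add (u.integrable_smul hψ hc) (v.integrable_smul hψ hc)]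
  refine integral_congr_ae ?_
  filter_upwards [Lp.coeFn_add u v] with t ht
  rw [ht, Pi.add_apply, smul_add]

theorem L2Pos.setIntegral_smul (c : ℂ) (u : L2Pos) (ψ : ℝ → ℝ) :
    ∫ t in Ioi (0 : ℝ), ψ t • (c • u : L2Pos) t = c * ∫ t in Ioi (0 : ℝ), ψ t • u t := by
  rw [← integral_const_mul]
  refine integral_congr_ae ?_
  filter_upwards [Lp.coeFn_smul c u] with t ht
  simp only [ht, Pi.smul_apply, smul_eq_mul, Complex.real_smul]
  ring

/-- The graph of the weak derivative in `L²(ℝ₊)`. -/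
def weakDerivGraph : Submodule ℂ (L2Pos × L2Pos) where
  carrier := {p | IsWeakDeriv p.1 p.2}
  zero_mem' := by
    intro ψ _ _ _
    have h : ∀ χ : ℝ → ℝ, ∫ t in Ioi (0 : ℝ), χ t • (0 : L2Pos) t = 0 := by
      intro χ
      simpa using L2Pos.setIntegral_smul 0 0 χ
    simp only [Prod.fst_zero, Prod.snd_zero, h, neg_zero]
  add_mem' := by
    rintro ⟨a, b⟩ ⟨a', b'⟩ h h' ψ h1 h2 h3
    have e := h ψ h1 h2 h3
    have e' := h' ψ h1 h2 h3
    simp only [Prod.fst_add, Prod.snd_add] at e e' ⊢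
    rw [L2Pos.setIntegral_add _ _ (h1.continuous_deriv (by simp)) h2.deriv,
      L2Pos.setIntegral_add _ _ h1.continuous h2, e, e']
    ring
  smul_mem' := by
    rintro c ⟨a, b⟩ h ψ h1 h2 h3
    have e := h ψ h1 h2 h3
    simp only [Prod.smul_fst, Prod.smul_snd] at e ⊢
    rw [L2Pos.setIntegral_smul, L2Pos.setIntegral_smul, e]
    ring

/-- Weak derivatives are unique, so that `weakDerivGraph` is the graph of an operator. -/
theorem weakDerivGraph_single (x : L2Pos × L2Pos) (hx : x ∈ weakDerivGraph) (h0 : x.1 = 0) :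
    x.2 = 0 := by
  obtain ⟨u, v⟩ := x
  obtain rfl : u = 0 := h0
  have hz : ∀ χ : ℝ → ℝ, ∫ t in Ioi (0 : ℝ), χ t • (0 : L2Pos) t = 0 := by
    intro χ
    simpa using L2Pos.setIntegral_smul 0 0 χ
  have key := (isOpen_Ioi (a := (0 : ℝ))).ae_eq_zero_of_integral_contDiff_smul_eq_zero
    (μ := (volume : Measure ℝ).restrict (Ioi 0)) (f := v)
    (((Lp.memLp v).locallyIntegrable (by norm_num)).locallyIntegrableOn _) (by
      intro ψ h1 h2 h3
      have e := hx ψ h1 h2 h3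
      simp only [hz] at e
      simpa using e.symm)
  refine Lp.ext ?_
  filter_upwards [key, ae_restrict_mem measurableSet_Ioi, Lp.coeFn_zero ℂ 2
    ((volume : Measure ℝ).restrict (Ioi 0))] with t h h' h''
  rw [h h', h'']
  rfl

/-- The operator `∂_t` on `L²(ℝ₊)`: the weak derivative, with its maximal domain (the Sobolev space
`H¹(0, ∞)`). -/
def timeDeriv : L2Pos →ₗ.[ℂ] L2Pos := weakDerivGraph.toLinearPMap

theorem timeDeriv_graph : timeDeriv.graph = weakDerivGraph :=
  weakDerivGraph.toLinearPMap_graph_eq weakDerivGraph_single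

end

/-! Let `S` be the `L²` sum of `∑ aₙ ∂ₜⁿ φ`, where `aₙ = f⁽ⁿ⁾(0)/n!`, and put `r_e = f 𝓛(φ) - 𝓛(S)`
on `ℂ₊`. Then `f 𝓛(φ) - r_e = 𝓛(S)`, which lies in `H²` by Plancherel. To identify `r_e` with `r`,
fix `s ∈ ℂ₊` with `|s| < R₁`. Evaluating `𝓛` at `s` is a bounded functional on `L²(ℝ₊)`, so `𝓛(S)(s)
= ∑ aₙ 𝓛(φ⁽ⁿ⁾)(s)`. Repeated integration by parts turns the `n`-th term into `aₙ sⁿ 𝓛(φ)(s)` minus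
the `n`-th term of `r`, and `∑ aₙ sⁿ = f(s)`. The series `r` converges because the `d_j` are bounded
and `R₁ > 1`. -/

/-! ### Plancherel on `L¹ ∩ L²`. -/

open scoped FourierTransform SchwartzMap in
theorem fourier_toLp_ae_eq {g : ℝ → ℂ} (h1 : Integrable g) (h2 : MemLp g 2) :
    (𝓕 (h2.toLp g) : Lp ℂ 2 (volume : Measure ℝ)) =ᵐ[volume] 𝓕 g := by
  have hc : Continuous (𝓕 g) :=
    VectorFourier.fourierIntegral_continuous Real.continuous_fourierChar
      (L := innerₗ ℝ) (by exact continuous_inner) h1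
  refine ae_eq_of_integral_contDiff_smul_eq
    ((Lp.memLp _).locallyIntegrable (by norm_num)) hc.locallyIntegrable ?_
  intro ψ hψ hψc
  have hc1 : HasCompactSupport (Complex.ofRealCLM ∘ ψ) := hψc.comp_left rfl
  have hc2 : ContDiff ℝ ∞ (Complex.ofRealCLM ∘ ψ) := by fun_prop
  -- Tested against `ψ`, both transforms move onto `ψ`: by duality of tempered distributions for the
  -- `L²` one, by Fubini (`hswap`) for the integral one.
  have key := congrArg (fun T : 𝓢'(ℝ, ℂ) => T (hc1.toSchwartzMap hc2))
    (Lp.fourier_toTemperedDistribution_eq (h2.toLp g))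
  simp only [TemperedDistribution.fourier_apply, Lp.toTemperedDistribution_apply,
    SchwartzMap.fourier_coe] at key
  have hval : ∀ x, (hc1.toSchwartzMap hc2) x = (ψ x : ℂ) := fun x => rfl
  simp only [hval, smul_eq_mul] at key
  simp only [Complex.real_smul]
  rw [← key]
  have hswap := VectorFourier.integral_fourierIntegral_smul_eq_flip (μ := (volume : Measure ℝ))
    (ν := (volume : Measure ℝ)) (L := innerₗ ℝ) Real.continuous_fourierChar
    (by exact continuous_inner) (hc1.toSchwartzMap hc2).integrable h1
  rw [flip_innerₗ] at hswap
  refine Eq.trans ?_ hswap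
  refine integral_congr_ae ?_
  filter_upwards [h2.coeFn_toLp] with x hx
  rw [hx]
  rfl

open scoped FourierTransform in
/-- **Plancherel's theorem** for the Fourier integral of a function in `L¹ ∩ L²`. -/
theorem eLpNorm_fourier_eq {g : ℝ → ℂ} (h1 : Integrable g) (h2 : MemLp g 2) :
    eLpNorm (𝓕 g) 2 volume = eLpNorm g 2 volume := by
  rw [← eLpNorm_congr_ae (fourier_toLp_ae_eq h1 h2), ← Lp.enorm_def, ← eLpNorm_congr_ae
    h2.coeFn_toLp, ← Lp.enorm_def, ← ofReal_norm, ← ofReal_norm, Lp.norm_fourier_eq]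

/-! ### The Laplace transform on `L²(ℝ₊)`. -/

theorem memLp_exp_neg_mul {s : ℂ} (hs : 0 < s.re) :
    MemLp (fun t : ℝ => Complex.exp (-s * t)) 2 ((volume : Measure ℝ).restrict (Ioi 0)) := by
  rw [memLp_two_iff_integrable_sq_norm (by fun_prop)]
  have h := exp_neg_integrableOn_Ioi 0 (b := 2 * s.re) (by positivity)
  refine h.congr_fun (fun t _ => ?_) measurableSet_Ioi
  simp only [Complex.norm_exp, ← Real.exp_nat_mul]
  congr 1
  simp
  ring

theorem integrable_exp_mul {g : ℝ → ℂ} (hg : MemLp g 2 ((volume : Measure ℝ).restrict (Ioi 0)))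
    {s : ℂ} (hs : 0 < s.re) :
    IntegrableOn (fun t : ℝ => Complex.exp (-s * t) * g t) (Ioi 0) :=
  (memLp_exp_neg_mul hs).integrable_mul hg

theorem laplace_congr {g h : ℝ → ℂ} (H : g =ᵐ[(volume : Measure ℝ).restrict (Ioi 0)] h) (s : ℂ) :
    laplace g s = laplace h s :=
  integral_congr_ae (by filter_upwards [H] with t ht; rw [ht])

/-- For `Re s > 0`, the Laplace transform at `s` is a continuous linear functional on `L²(ℝ₊)`. -/
theorem exists_laplace_continuousLinearMap {s : ℂ} (hs : 0 < s.re) :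
    ∃ T : L2Pos →L[ℂ] ℂ, ∀ u : L2Pos, T u = laplace u s := by
  have hm : MemLp (fun t : ℝ => Complex.exp (-(starRingEnd ℂ s) * t)) 2
      ((volume : Measure ℝ).restrict (Ioi 0)) := memLp_exp_neg_mul (by simpa using hs)
  refine ⟨innerSL ℂ (hm.toLp _), fun u => ?_⟩
  rw [innerSL_apply_apply, L2.inner_def, laplace]
  refine integral_congr_ae ?_
  filter_upwards [hm.coeFn_toLp] with t ht
  rw [ht, RCLike.inner_apply, mul_comm]
  congr 1
  rw [← Complex.exp_conj]
  simp

theorem differentiableOn_laplace {g : ℝ → ℂ}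
    (hg : MemLp g 2 ((volume : Measure ℝ).restrict (Ioi 0))) :
    DifferentiableOn ℂ (laplace g) rightHalfPlane := by
  intro s hs
  have hs : 0 < s.re := hs
  -- On `Re z > 2δ`, `t e^{-t Re z} ≤ δ⁻¹ e^{-δt}`: half of the decay absorbs the factor `t`, the
  -- other half keeps the bound integrable against `g`.
  set δ : ℝ := s.re / 4 with hδ
  have hδ0 : 0 < δ := by positivity
  have hU : {z : ℂ | 2 * δ < z.re} ∈ 𝓝 s :=
    (isOpen_lt continuous_const Complex.continuous_re).mem_nhds (by
      show 2 * δ < s.re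
      rw [hδ]; linarith)
  have hmeas : ∀ z : ℂ, AEStronglyMeasurable (fun t : ℝ => Complex.exp (-z * t))
      ((volume : Measure ℝ).restrict (Ioi 0)) := fun z => by
    exact (by fun_prop : Continuous fun t : ℝ => Complex.exp (-z * t)).aestronglyMeasurable
  have hbi := ((integrable_exp_mul hg (s := (δ : ℂ)) (by simpa using hδ0)).norm).const_mul (1 / δ)
  have := hasDerivAt_integral_of_dominated_loc_of_deriv_le (𝕜 := ℂ)
    (μ := (volume : Measure ℝ).restrict (Ioi 0)) (x₀ := s)
    (F := fun z t => Complex.exp (-z * t) * g t)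
    (F' := fun z t => Complex.exp (-z * t) * (-(t : ℂ)) * g t)
    (bound := fun t => (1 / δ) * ‖Complex.exp (-(δ : ℂ) * t) * g t‖) hU
    (Eventually.of_forall fun z => (hmeas z).mul hg.1)
    (integrable_exp_mul hg hs)
    (((hmeas s).mul (by
      exact (by fun_prop : Continuous fun t : ℝ => -(t : ℂ)).aestronglyMeasurable)).mul hg.1)
    ?_ hbi ?_
  · exact this.2.differentiableAt.differentiableWithinAt
  · filter_upwards [ae_restrict_mem measurableSet_Ioi] with t ht z hz
    have ht : 0 < t := ht
    have hz : 2 * δ < z.re := hz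
    simp only [norm_mul, Complex.norm_exp, norm_neg, Complex.norm_real, Real.norm_eq_abs,
      abs_of_pos ht]
    rw [← mul_assoc]
    refine mul_le_mul_of_nonneg_right ?_ (norm_nonneg _)
    have e1 : (-z * t).re = -(z.re * t) := by simp
    have e2 : (-(δ : ℂ) * t).re = -(δ * t) := by simp
    rw [e1, e2]
    have h3 : t ≤ 1 / δ * Real.exp (δ * t) := by
      rw [one_div, ← div_eq_inv_mul, le_div_iff₀ hδ0]
      nlinarith [Real.add_one_le_exp (δ * t)]
    calc Real.exp (-(z.re * t)) * t ≤ Real.exp (-(2 * δ * t)) * (1 / δ * Real.exp (δ * t)) := by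
          gcongr
      _ = 1 / δ * Real.exp (-(δ * t)) := by
          rw [mul_left_comm, ← Real.exp_add]
          ring_nf
  · refine Eventually.of_forall fun t z _ => ?_
    have h : HasDerivAt (fun z : ℂ => -z * t) (-(t : ℂ)) z := by
      simpa using ((hasDerivAt_id z).neg.mul_const (t : ℂ))
    exact (h.cexp).mul_const (g t)

theorem laplace_eq_fourier (g : ℝ → ℂ) (x y : ℝ) :
    laplace g ((x : ℂ) + (y : ℂ) * Complex.I) =
      FourierTransform.fourier ((Ioi (0 : ℝ)).indicator fun t => Complex.exp (-(x : ℂ) * t) * g t)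
        (y / (2 * Real.pi)) := by
  rw [Real.fourier_eq', laplace, ← integral_indicator measurableSet_Ioi]
  refine integral_congr_ae (Eventually.of_forall fun t => ?_)
  by_cases ht : t ∈ Ioi (0 : ℝ)
  · simp only [indicator_of_mem ht, smul_eq_mul, ← mul_assoc, ← Complex.exp_add]
    congr 2
    have hp : (Real.pi : ℂ) ≠ 0 := by exact_mod_cast Real.pi_ne_zero
    simp only [RCLike.inner_apply, conj_trivial]
    push_cast
    field_simp
    ring
  · simp [indicator_of_notMem ht]

/-- The `1/2π` in `hardyMean` is exactly the Jacobian of the frequency rescaling. No measurability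
of `F` is needed, as the scaling is a measurable equivalence. -/
theorem lintegral_comp_div_two_pi (F : ℝ → ℝ≥0∞) :
    ENNReal.ofReal (1 / (2 * Real.pi)) * ∫⁻ y : ℝ, F (y / (2 * Real.pi)) = ∫⁻ y : ℝ, F y := by
  have hp : (2 * Real.pi)⁻¹ ≠ 0 := by positivity
  have h := lintegral_map_equiv (μ := (volume : Measure ℝ)) F
    (Homeomorph.mulLeft₀ _ hp).toMeasurableEquiv
  simp only [Homeomorph.toMeasurableEquiv_coe, Homeomorph.coe_mulLeft₀,
    Real.map_volume_mul_left hp, lintegral_smul_measure, inv_inv] at h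
  simp only [div_eq_inv_mul, mul_one]
  rw [← h, smul_eq_mul, ← mul_assoc, ← ENNReal.ofReal_mul (by positivity), abs_of_pos
    (by positivity), inv_mul_cancel₀ (by positivity), ENNReal.ofReal_one, one_mul]

/-- The Laplace transform of an `L²(ℝ₊)` function belongs to `H²(ℂ₊)`. -/
theorem laplace_mem_hardySpace (u : L2Pos) : laplace u ∈ hardySpace 2 := by
  have hopen : IsOpen rightHalfPlane := isOpen_lt continuous_const Complex.continuous_re
  refine ⟨(differentiableOn_laplace (Lp.memLp u)).analyticOnNhd hopen, ‖u‖₊, fun x hx => ?_⟩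
  set G : ℝ → ℂ := (Ioi (0 : ℝ)).indicator fun t => Complex.exp (-(x : ℂ) * t) * u t with hG
  have h1 : Integrable G := (integrable_indicator_iff measurableSet_Ioi).2
    (integrable_exp_mul (Lp.memLp u) (by simpa using hx))
  -- The damping factor has modulus at most `1`, which makes the bound uniform in `x`.
  have hle : ∀ᵐ t : ℝ ∂(volume : Measure ℝ).restrict (Ioi 0),
      ‖Complex.exp (-(x : ℂ) * t) * u t‖ ≤ ‖u t‖ := by
    filter_upwards [ae_restrict_mem measurableSet_Ioi] with t ht
    have ht : 0 < t := ht
    rw [norm_mul, Complex.norm_exp]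
    refine mul_le_of_le_one_left (norm_nonneg _) (Real.exp_le_one_iff.2 ?_)
    simpa using (mul_pos hx ht).le
  have h2' : MemLp (fun t : ℝ => Complex.exp (-(x : ℂ) * t) * u t) 2
      ((volume : Measure ℝ).restrict (Ioi 0)) :=
    (Lp.memLp u).mono
      ((memLp_exp_neg_mul (s := (x : ℂ)) (by simpa using hx)).1.mul (Lp.memLp u).1) hle
  have h2 : MemLp G 2 := (memLp_indicator_iff_restrict measurableSet_Ioi).2 h2'
  have hmean : hardyMean 2 (laplace u) x = eLpNorm (FourierTransform.fourier G) 2 volume := by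
    rw [hardyMean, eLpNorm_eq_lintegral_rpow_enorm_toReal (by norm_num) (by norm_num)]
    simp only [laplace_eq_fourier, ENNReal.toReal_ofNat]
    rw [lintegral_comp_div_two_pi (fun ξ => ‖FourierTransform.fourier G ξ‖ₑ ^ (2 : ℝ))]
  rw [hmean, eLpNorm_fourier_eq h1 h2, hG, eLpNorm_indicator_eq_eLpNorm_restrict measurableSet_Ioi]
  refine (eLpNorm_mono_ae hle).trans ?_
  rw [← Lp.enorm_def]
  rfl

/-! ### Weak and classical derivatives on the half-line. -/

theorem locallyIntegrable_restrict_Ioi {v : ℝ → ℂ} (hv : ContinuousOn v (Ici 0)) :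
    LocallyIntegrable v ((volume : Measure ℝ).restrict (Ioi 0)) := by
  rw [restrict_Ioi_eq_restrict_Ici,
    ← locallyIntegrableOn_iff_locallyIntegrable_restrict isClosed_Ici]
  exact hv.locallyIntegrableOn measurableSet_Ici

theorem isWeakDeriv_of_hasDerivAt {v v' : ℝ → ℂ} (hv : ContinuousOn v (Ici 0))
    (hv' : ContinuousOn v' (Ici 0)) (h : ∀ t ∈ Ioi (0 : ℝ), HasDerivAt v (v' t) t) :
    IsWeakDeriv v v' := by
  intro ψ hψ hc hsub
  have i1 := (locallyIntegrable_restrict_Ioi hv).integrable_smul_left_of_hasCompactSupport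
    (hψ.continuous_deriv (by simp)) hc.deriv
  have i2 := (locallyIntegrable_restrict_Ioi hv').integrable_smul_left_of_hasCompactSupport
    hψ.continuous hc
  have i3 := (locallyIntegrable_restrict_Ioi hv).integrable_smul_left_of_hasCompactSupport
    hψ.continuous hc
  have hder : ∀ t ∈ Ioi (0 : ℝ), HasDerivAt (fun t => ψ t • v t)
      (ψ t • v' t + deriv ψ t • v t) t := fun t ht =>
    ((hψ.differentiable (by simp)) t).hasDerivAt.smul (h t ht)
  have h0 : ψ 0 = 0 := by
    by_contra hne
    exact lt_irrefl (0 : ℝ) (hsub (subset_tsupport _ hne))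
  have key := integral_Ioi_of_hasDerivAt_of_tendsto
    ((hψ.continuous.continuousWithinAt).smul (hv 0 self_mem_Ici)) hder (i2.add i1)
    (tendsto_zero_of_hasDerivAt_of_integrableOn_Ioi hder (i2.add i1) i3)
  rw [integral_add i2 i1, Pi.smul_apply', h0, zero_smul, sub_zero] at key
  exact eq_neg_of_add_eq_zero_right key

/-- Weak derivatives are unique almost everywhere. -/
theorem IsWeakDeriv.ae_eq {u u' v w : ℝ → ℂ} (hv : IsWeakDeriv u v) (hw : IsWeakDeriv u' w)
    (hu : u =ᵐ[(volume : Measure ℝ).restrict (Ioi 0)] u')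
    (lv : LocallyIntegrable v ((volume : Measure ℝ).restrict (Ioi 0)))
    (lw : LocallyIntegrable w ((volume : Measure ℝ).restrict (Ioi 0))) :
    v =ᵐ[(volume : Measure ℝ).restrict (Ioi 0)] w := by
  have key := (isOpen_Ioi (a := (0 : ℝ))).ae_eq_zero_of_integral_contDiff_smul_eq_zero
    (μ := (volume : Measure ℝ).restrict (Ioi 0)) (f := v - w)
    ((lv.sub lw).locallyIntegrableOn _) (by
      intro ψ h1 h2 h3
      have e : ∫ t in Ioi (0 : ℝ), deriv ψ t • u t = ∫ t in Ioi (0 : ℝ), deriv ψ t • u' t :=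
        integral_congr_ae (by filter_upwards [hu] with t ht; rw [ht])
      rw [hv ψ h1 h2 h3, hw ψ h1 h2 h3, neg_inj] at e
      simp only [Pi.sub_apply, smul_sub]
      rw [integral_sub (lv.integrable_smul_left_of_hasCompactSupport h1.continuous h2)
        (lw.integrable_smul_left_of_hasCompactSupport h1.continuous h2), e, sub_self])
  filter_upwards [key, ae_restrict_mem measurableSet_Ioi] with t h h'
  exact sub_eq_zero.1 (h h')

/-- Integration by parts; the boundary term at infinity vanishes because `e^{-st} v` and its
derivative are both integrable. -/
theorem laplace_deriv {v v' : ℝ → ℂ} (hv : ContinuousWithinAt v (Ici 0) 0)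
    (h : ∀ t ∈ Ioi (0 : ℝ), HasDerivAt v (v' t) t)
    (m : MemLp v 2 ((volume : Measure ℝ).restrict (Ioi 0)))
    (m' : MemLp v' 2 ((volume : Measure ℝ).restrict (Ioi 0))) {s : ℂ} (hs : 0 < s.re) :
    laplace v' s = s * laplace v s - v 0 := by
  have i1 := (integrable_exp_mul m hs).const_mul (-s)
  have i2 := integrable_exp_mul m' hs
  have hder : ∀ t ∈ Ioi (0 : ℝ), HasDerivAt (fun t : ℝ => Complex.exp (-s * t) * v t)
      (-s * (Complex.exp (-s * t) * v t) + Complex.exp (-s * t) * v' t) t := by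
    intro t ht
    have e : HasDerivAt (fun t : ℝ => -s * (t : ℂ)) (-s) t := by
      simpa using (Complex.ofRealCLM.hasDerivAt (x := t)).const_mul (-s)
    refine (e.cexp.mul (h t ht)).congr_deriv ?_
    ring
  have hcont : ContinuousWithinAt (fun t : ℝ => Complex.exp (-s * t) * v t) (Ici 0) 0 :=
    (by fun_prop : Continuous fun t : ℝ => Complex.exp (-s * t)).continuousWithinAt.mul hv
  have key := integral_Ioi_of_hasDerivAt_of_tendsto hcont hder (i1.add i2)
    (tendsto_zero_of_hasDerivAt_of_integrableOn_Ioi hder (i1.add i2) (integrable_exp_mul m hs))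
  rw [integral_add i1 i2, integral_const_mul] at key
  simp only [Complex.ofReal_zero, mul_zero, Complex.exp_zero, one_mul, zero_sub] at key
  rw [laplace, laplace]
  linear_combination key

section HalfLine

variable {φ : ℝ → ℂ} (hφ : ContDiffOn ℝ ∞ φ (Ici 0))

include hφ

theorem continuousOn_iteratedDerivWithin_Ici (n : ℕ) :
    ContinuousOn (iteratedDerivWithin n φ (Ici 0)) (Ici 0) :=
  hφ.continuousOn_iteratedDerivWithin (by exact_mod_cast le_top) (uniqueDiffOn_Ici 0)

theorem hasDerivAt_iteratedDerivWithin_Ici (n : ℕ) {t : ℝ} (ht : t ∈ Ioi (0 : ℝ)) :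
    HasDerivAt (iteratedDerivWithin n φ (Ici 0)) (iteratedDerivWithin (n + 1) φ (Ici 0) t) t := by
  have hd := hφ.differentiableOn_iteratedDerivWithin (m := n) (by exact_mod_cast ENat.natCast_lt_top n)
    (uniqueDiffOn_Ici 0) t (Ioi_subset_Ici_self ht)
  rw [iteratedDerivWithin_succ]
  exact hd.hasDerivWithinAt.hasDerivAt (Ici_mem_nhds ht)

/-- The iterates of `∂_t` on a smooth function are its classical derivatives. -/
theorem timeDeriv_iterate_ae_eq {w : ℕ → L2Pos}
    (h0 : w 0 =ᵐ[(volume : Measure ℝ).restrict (Ioi 0)] φ)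
    (hw : ∀ n, ∃ h : w n ∈ timeDeriv.domain, timeDeriv ⟨w n, h⟩ = w (n + 1)) (n : ℕ) :
    w n =ᵐ[(volume : Measure ℝ).restrict (Ioi 0)] iteratedDerivWithin n φ (Ici 0) := by
  induction n with
  | zero => simpa using h0
  | succ n ih =>
    have hg : (w n, w (n + 1)) ∈ weakDerivGraph := by
      rw [← timeDeriv_graph, LinearPMap.mem_graph_iff]
      obtain ⟨h, e⟩ := hw n
      exact ⟨⟨w n, h⟩, rfl, e⟩
    have hg : IsWeakDeriv (w n) (w (n + 1)) := hg
    have hc := continuousOn_iteratedDerivWithin_Ici hφ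
    exact hg.ae_eq (isWeakDeriv_of_hasDerivAt (hc n) (hc (n + 1))
      fun t ht => hasDerivAt_iteratedDerivWithin_Ici hφ n ht) ih
      ((Lp.memLp _).locallyIntegrable (by norm_num)) (locallyIntegrable_restrict_Ioi (hc _))

theorem laplace_iteratedDerivWithin
    (m : ∀ n, MemLp (iteratedDerivWithin n φ (Ici 0)) 2 ((volume : Measure ℝ).restrict (Ioi 0)))
    {s : ℂ} (hs : 0 < s.re) (n : ℕ) :
    laplace (iteratedDerivWithin n φ (Ici 0)) s = s ^ n * laplace φ s -
      ∑ j ∈ Finset.Icc 1 n, iteratedDerivWithin (j - 1) φ (Ici 0) 0 * s ^ (n - j) := by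
  induction n with
  | zero => simp
  | succ n ih =>
    rw [laplace_deriv (continuousOn_iteratedDerivWithin_Ici hφ n 0 self_mem_Ici)
      (fun t ht => hasDerivAt_iteratedDerivWithin_Ici hφ n ht) (m n) (m (n + 1)) hs, ih,
      Finset.sum_Icc_succ_top (by omega), mul_sub, Finset.mul_sum]
    have : ∀ j ∈ Finset.Icc 1 n, s * (iteratedDerivWithin (j - 1) φ (Ici 0) 0 * s ^ (n - j)) =
        iteratedDerivWithin (j - 1) φ (Ici 0) 0 * s ^ (n + 1 - j) := by
      intro j hj
      rw [Nat.succ_sub (Finset.mem_Icc.1 hj).2, pow_succ]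
      ring
    rw [Finset.sum_congr rfl this]
    simp
    ring

end HalfLine

/-! ### Convergence of the series `r`. -/

/-- Since `R < 1`, the series converges at `s = 1`, so its terms `d n` tend to zero. -/
theorem ConvergesOutsideSmallDisc.exists_bound {d : ℕ → ℂ} (h : ConvergesOutsideSmallDisc d) :
    ∃ C : ℝ, ∀ n, ‖d n‖ ≤ C := by
  obtain ⟨R, hR0, hR1, g, hg⟩ := h
  have ht := (hg {1} isCompact_singleton (by simpa using hR1)).tendsto_at (mem_singleton 1)
  simp only [one_pow, div_one] at ht
  have h2 := (ht.comp (tendsto_add_atTop_nat 1)).sub ht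
  simp only [Function.comp_def, sub_self] at h2
  have h3 : Tendsto d atTop (𝓝 0) := by
    refine h2.congr fun n => ?_
    rw [Finset.sum_Icc_succ_top (by omega)]
    simp
  obtain ⟨C, hC⟩ := h3.norm.bddAbove_range
  exact ⟨C, fun n => hC ⟨n, rfl⟩⟩

/-- There are `n` summands, and `ρ ≥ 1` allows every power `ρ ^ (n - j)` to be replaced by `ρ ^ n`.
-/
theorem norm_rTerm_le {f : ℂ → ℂ} {d : ℕ → ℂ} {C ρ : ℝ} (hd : ∀ n, ‖d n‖ ≤ C) (hρ : 1 ≤ ρ) {s : ℂ}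
    (hs : ‖s‖ ≤ ρ) (n : ℕ) : ‖rTerm f d s n‖ ≤ C * (n * (‖taylorCoeff f n‖ * ρ ^ n)) := by
  have hC : 0 ≤ C := (norm_nonneg _).trans (hd 0)
  calc ‖rTerm f d s n‖ ≤ ∑ j ∈ Finset.Icc 1 n, ‖taylorCoeff f n‖ * C * ρ ^ n := by
        refine norm_sum_le_of_le _ fun j _ => ?_
        rw [norm_mul, norm_mul, norm_pow]
        gcongr
        · exact hd _
        · calc ‖s‖ ^ (n - j) ≤ ρ ^ (n - j) := by gcongr
            _ ≤ ρ ^ n := pow_le_pow_right₀ hρ (Nat.sub_le _ _)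
    _ = C * (n * (‖taylorCoeff f n‖ * ρ ^ n)) := by
        simp
        ring

theorem summable_nat_mul_taylorCoeff {f : ℂ → ℂ} {ρ : ℝ≥0} (hρ : (ρ : ℝ≥0∞) < taylorRadius f) :
    Summable fun n : ℕ => (n : ℝ) * (‖taylorCoeff f n‖ * (ρ : ℝ) ^ n) := by
  -- The room between `ρ` and `σ` gives a geometric factor `(ρ/σ)ⁿ` that absorbs `n`.
  obtain ⟨σ, h1, h2⟩ := ENNReal.lt_iff_exists_nnreal_btwn.1 hρ
  have h1 : (ρ : ℝ) < σ := by exact_mod_cast h1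
  obtain ⟨C, hC, hb⟩ := (FormalMultilinearSeries.ofScalars ℂ
    (taylorCoeff f)).norm_mul_pow_le_of_lt_radius h2
  have hσ : 0 < (σ : ℝ) := lt_of_le_of_lt ρ.2 h1
  have hs : Summable fun n : ℕ => ((n : ℝ) ^ 1 * ((ρ : ℝ) / σ) ^ n) :=
    summable_pow_mul_geometric_of_norm_lt_one 1 (by
      rw [Real.norm_of_nonneg (by positivity)]
      exact (div_lt_one hσ).2 h1)
  refine (hs.mul_left C).of_nonneg_of_le (fun n => by positivity) fun n => ?_
  have hn := hb n
  rw [FormalMultilinearSeries.ofScalars_norm] at hn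
  calc (n : ℝ) * (‖taylorCoeff f n‖ * (ρ : ℝ) ^ n)
      = (‖taylorCoeff f n‖ * (σ : ℝ) ^ n) * ((n : ℝ) ^ 1 * ((ρ : ℝ) / σ) ^ n) := by
        rw [div_pow]
        field_simp
    _ ≤ _ := by gcongr

theorem exists_nnreal_between {f : ℂ → ℂ} (hR : 1 < taylorRadius f) {s : ℂ}
    (hs : s ∈ taylorDisc f) :
    ∃ ρ : ℝ≥0, 1 ≤ ρ ∧ ‖s‖ < ρ ∧ (ρ : ℝ≥0∞) < taylorRadius f := by
  obtain ⟨ρ, h1, h2⟩ := ENNReal.lt_iff_exists_nnreal_btwn.1 (max_lt hR hs)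
  refine ⟨ρ, ?_, ?_, h2⟩
  · exact_mod_cast ((le_max_left _ _).trans_lt h1).le
  · have h := (le_max_right _ _).trans_lt h1
    rw [enorm_eq_nnnorm] at h
    exact_mod_cast h

theorem summable_rTerm {f : ℂ → ℂ} {d : ℕ → ℂ} {C : ℝ} (hd : ∀ n, ‖d n‖ ≤ C)
    (hR : 1 < taylorRadius f) {s : ℂ} (hs : s ∈ taylorDisc f) : Summable (rTerm f d s) := by
  obtain ⟨ρ, h1, h2, h3⟩ := exists_nnreal_between hR hs
  exact Summable.of_norm_bounded ((summable_nat_mul_taylorCoeff h3).mul_left C)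
    (norm_rTerm_le hd h1 h2.le)

theorem analyticOnNhd_rSeries {f : ℂ → ℂ} {d : ℕ → ℂ} {C : ℝ} (hd : ∀ n, ‖d n‖ ≤ C)
    (hR : 1 < taylorRadius f) : AnalyticOnNhd ℂ (rSeries f d) (taylorDisc f) := by
  intro s hs
  obtain ⟨ρ, h1, h2, h3⟩ := exists_nnreal_between hR hs
  have hdiff : DifferentiableOn ℂ (rSeries f d) (Metric.ball 0 ρ) := by
    refine Complex.differentiableOn_tsum_of_summable_norm
      ((summable_nat_mul_taylorCoeff h3).mul_left C) (F := fun n s => rTerm f d s n)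
      (fun n => ?_) Metric.isOpen_ball
      fun n w hw => norm_rTerm_le hd h1 (by simpa using (mem_ball_zero_iff.1 hw).le) n
    unfold rTerm
    fun_prop
  exact hdiff.analyticOnNhd Metric.isOpen_ball s (by simpa using h2)

/-- The Taylor series of `f` at `0` sums to `f` on the part of its disc of convergence in `ℂ₊`. -/
theorem hasSum_taylorCoeff {f : ℂ → ℂ} (hf0 : AnalyticAt ℂ f 0)
    (hf : AnalyticOnNhd ℂ f rightHalfPlane) {s : ℂ} (hs : s ∈ rightHalfPlane)
    (hsd : s ∈ taylorDisc f) : HasSum (fun n => taylorCoeff f n * s ^ n) (f s) := by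
  set p := FormalMultilinearSeries.ofScalars ℂ (taylorCoeff f) with hp
  have hball : taylorDisc f = Metric.eball (0 : ℂ) p.radius := by
    ext z
    simp [taylorDisc, taylorRadius, hp]
  have hpos : 0 < p.radius := lt_of_le_of_lt zero_le hsd
  obtain ⟨ε, hε⟩ : HasFPowerSeriesAt f p 0 := hf0.hasFPowerSeriesAt
  have hg := p.hasFPowerSeriesOnBall hpos
  have hnear : f =ᶠ[𝓝 0] p.sum := by
    filter_upwards [Metric.eball_mem_nhds (0 : ℂ) hε.r_pos] with z hz
    have h1 := hε.sum hz
    simpa using h1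
  obtain ⟨δ, hδ, hsub⟩ := Metric.eventually_nhds_iff_ball.1 (eventually_eventually_nhds.2 hnear)
  -- The identity theorem is applied on the convex set `ℂ₊ ∩ {|z| < R₁}`. It does not contain `0`,
  -- so the germs are compared at a small positive real `x`.
  set x : ℝ := min (δ / 2) (‖s‖ / 2) with hx
  have hs0 : 0 < ‖s‖ := norm_pos_iff.2 (by rintro rfl; exact lt_irrefl (0 : ℝ) hs)
  have hx0 : 0 < x := lt_min (by positivity) (by positivity)
  have hxn : ‖(x : ℂ)‖ = x := by simp [abs_of_pos hx0]
  have hconv : Convex ℝ (rightHalfPlane ∩ taylorDisc f) := by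
    rw [hball]
    exact (convex_halfSpace_re_gt 0).inter (convex_eball _ _)
  have heq := (hf.mono inter_subset_left).eqOn_of_preconnected_of_eventuallyEq
    (hg.analyticOnNhd.mono (by rw [← hball]; exact inter_subset_right))
    hconv.isPreconnected (z₀ := (x : ℂ)) ⟨by simpa [rightHalfPlane] using hx0, ?_⟩
    (hsub _ (by
      rw [mem_ball_zero_iff, hxn]
      exact (min_le_left _ _).trans_lt (by linarith)))
  · rw [heq ⟨hs, hsd⟩]
    have h := hg.hasSum (y := s) (by rw [← hball]; exact hsd)
    simpa [hp, FormalMultilinearSeries.ofScalars_apply_eq, mul_comm] using h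
  · refine lt_of_le_of_lt (b := ‖s‖ₑ) ?_ hsd
    rw [enorm_le_iff_norm_le, hxn]
    exact (min_le_right _ _).trans (by linarith)

theorem proposition5
    (f : ℂ → ℂ) (Ω : Set ℂ) (hΩ : IsRegion Ω) (hΩ0 : (0 : ℂ) ∈ Ω) (hΩp : rightHalfPlane ⊆ Ω)
    (hf : AnalyticOnNhd ℂ f Ω) (hR : 1 < taylorRadius f)
    (φ : ℝ → ℂ) (hsmooth : ContDiffOn ℝ ∞ φ (Ici 0))
    (hL2 : MemLp φ 2 ((volume : Measure ℝ).restrict (Ioi 0)))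
    (hvec : IsAnalyticVector f timeDeriv (hL2.toLp φ))
    (hd : ConvergesOutsideSmallDisc (fun j => iteratedDerivWithin j φ (Ici 0) 0)) :
    (∀ s ∈ taylorDisc f,
      Summable (rTerm f (fun j => iteratedDerivWithin j φ (Ici 0) 0) s)) ∧
    AnalyticOnNhd ℂ (rSeries f (fun j => iteratedDerivWithin j φ (Ici 0) 0)) (taylorDisc f) ∧
    ∃ r_e : ℂ → ℂ, AnalyticOnNhd ℂ r_e rightHalfPlane ∧
      EqOn r_e (rSeries f (fun j => iteratedDerivWithin j φ (Ici 0) 0))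
        (rightHalfPlane ∩ taylorDisc f) ∧
      (hL2.toLp φ, r_e) ∈ domainD f := by
  obtain ⟨C, hC⟩ := hd.exists_bound
  set d : ℕ → ℂ := fun j => iteratedDerivWithin j φ (Ici 0) 0
  obtain ⟨w, hw0, hw, S, hS⟩ := hvec
  have hwn := timeDeriv_iterate_ae_eq hsmooth (w := w) (by rw [hw0]; exact hL2.coeFn_toLp) hw
  -- Square integrability of the classical derivatives is inherited from the iterates `w n`.
  have hm : ∀ n, MemLp (iteratedDerivWithin n φ (Ici 0)) 2
      ((volume : Measure ℝ).restrict (Ioi 0)) := fun n => (Lp.memLp (w n)).ae_eq (hwn n)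
  have hopen : IsOpen rightHalfPlane := isOpen_lt continuous_const Complex.continuous_re
  have hLS := laplace_mem_hardySpace S
  have hLφ : AnalyticOnNhd ℂ (laplace (hL2.toLp φ)) rightHalfPlane :=
    (differentiableOn_laplace (Lp.memLp _)).analyticOnNhd hopen
  have hre : AnalyticOnNhd ℂ (fun s => f s * laplace (hL2.toLp φ) s - laplace S s)
      rightHalfPlane := ((hf.mono hΩp).mul hLφ).sub hLS.1
  refine ⟨fun s hs => summable_rTerm hC hR hs, analyticOnNhd_rSeries hC hR,
    fun s => f s * laplace (hL2.toLp φ) s - laplace S s, hre, ?_,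
    ⟨rightHalfPlane, ⟨hopen, ⟨1, by simp [rightHalfPlane]⟩,
      (convex_halfSpace_re_gt 0).isPreconnected⟩, hre⟩, by simpa using hLS⟩
  rintro s ⟨hs, hsd⟩
  obtain ⟨T, hT⟩ := exists_laplace_continuousLinearMap hs
  have hlim := (T.continuous.tendsto S).comp hS
  simp only [Function.comp_def, map_sum, map_smul] at hlim
  have hsum := ((hasSum_taylorCoeff (hf 0 hΩ0) (hf.mono hΩp) hs hsd).mul_right
    (laplace φ s)).tendsto_sum_nat
  refine tendsto_nhds_unique ?_ (summable_rTerm hC hR hsd).hasSum.tendsto_sum_nat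
  simp only [hT, laplace_congr hL2.coeFn_toLp] at hlim ⊢
  -- Termwise, `aₙ sⁿ 𝓛(φ)(s) - aₙ 𝓛(φ⁽ⁿ⁾)(s)` is exactly the `n`-th term of `r`.
  refine (hsum.sub hlim).congr fun N => ?_
  rw [← Finset.sum_sub_distrib]
  refine Finset.sum_congr rfl fun n _ => ?_
  rw [laplace_congr (hwn n), laplace_iteratedDerivWithin hsmooth hm hs n, rTerm, smul_eq_mul,
    mul_sub, Finset.mul_sum]
  simp only [mul_assoc, sub_sub_cancel]
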